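/- Let $I\subseteq\mathbb R$ be a nonempty open interval and consider the equation $$u_t=a^2(t)\,u_{xx}+b(t)\,u-c(t)\,u^3,\qquad(\ast)$$ where $a,b,c\colon I\to\mathbb R$ are smooth and $a$ and $c$ vanish nowhere on $I$. Let $\Omega\subseteq I\times\mathbb R\times\mathbb R$ be an open set of points $(t,x,u)$ whose projection to the $t$-axis is all of $I$ (for instance $\Omega=I\times\mathbb R^2$). Say that $(\ast)$ is reduced over $\Omega$ to a constant-coefficient equation of the same class by a point transformation if there are constants $A\neq0$, $B$, $C\neq0$ and a smooth diffeomorphism $\Phi\colon(t,x,u)\mapsto(\tilde t,\tilde x,\tilde u)$ of $\Omega$ onto an open subset of $\mathbb R^3$ that maps $(\ast)$ to $$\tilde u_{\tilde t}=A^2\tilde u_{\tilde x\tilde x}+B\tilde u-C\tilde u^3,$$ that is, a 2-jet over $\Omega$ at which the second prolongation of $\Phi$ is defined satisfies $(\ast)$ if and only if its image under this prolongation satisfies the latter equation. Then $(\ast)$ is reduced over $\Omega$ to a constant-coefficient equation of the same class by a point transformation if and only if there is a constant $\lambda\in\mathbb R$ such that, for all $t\in I$, $$\frac{b}{a^2}+\frac12\,\frac{(c/a^2)_t}{c}=\lambda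 .$$ -/

import Mathlib

open scoped ContDiff

namespace NWS

/-- The space of independent and dependent variables: points `(t, x, u)`. -/
abbrev Jet0 : Type := ℝ × ℝ × ℝ

/-- The first-order jet space: points `((t, x, u), (u_t, u_x))`. -/
abbrev Jet1 : Type := Jet0 × (ℝ × ℝ)

/-- The second-order jet space of real functions `u = u(t, x)`. -/
@[ext] structure Jet2 where
  t : ℝ
  x : ℝ
  u : ℝ
  ut : ℝ
  ux : ℝ
  utt : ℝ
  utx : ℝ
  uxx : ℝ

/-- Projection `J² → J⁰`. -/
def Jet2.base (j : Jet2) : Jet0 := (j.t, j.x, j.u)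

/-- Projection `J² → J¹`. -/
def Jet2.toJet1 (j : Jet2) : Jet1 := ((j.t, j.x, j.u), (j.ut, j.ux))

/-- The equation `u_t = a(t)² u_xx + b(t) u - c(t) u³`, as a subset of the second-order
jet space. -/
def equation (a b c : ℝ → ℝ) : Set Jet2 :=
  {j | j.ut = a j.t ^ 2 * j.uxx + b j.t * j.u - c j.t * j.u ^ 3}

/-- The total derivative `D_t F = F_t + u_t F_u` of a function `F(t, x, u)`. -/
noncomputable def totalT0 (F : Jet0 → ℝ) (z : Jet1) : ℝ :=
  fderiv ℝ F z.1 (1, 0, z.2.1)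

/-- The total derivative `D_x F = F_x + u_x F_u` of a function `F(t, x, u)`. -/
noncomputable def totalX0 (F : Jet0 → ℝ) (z : Jet1) : ℝ :=
  fderiv ℝ F z.1 (0, 1, z.2.2)

/-- The total derivative `D_t G = G_t + u_t G_u + u_tt G_{u_t} + u_tx G_{u_x}` of a function
`G` on the first-order jet space. -/
noncomputable def totalT1 (G : Jet1 → ℝ) (j : Jet2) : ℝ :=
  fderiv ℝ G j.toJet1 ((1, 0, j.ut), (j.utt, j.utx))

/-- The total derivative `D_x G = G_x + u_x G_u + u_tx G_{u_t} + u_xx G_{u_x}` of a function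
`G` on the first-order jet space. -/
noncomputable def totalX1 (G : Jet1 → ℝ) (j : Jet2) : ℝ :=
  fderiv ℝ G j.toJet1 ((0, 1, j.ux), (j.utx, j.uxx))

/-- The component `T` of a transformation `t' = T(t, x, u)`, `x' = X(t, x, u)`, `u' = U(t, x, u)`. -/
def compT (Φ : Jet0 → Jet0) (p : Jet0) : ℝ := (Φ p).1

/-- The component `X` of a transformation. -/
def compX (Φ : Jet0 → Jet0) (p : Jet0) : ℝ := (Φ p).2.1

/-- The component `U` of a transformation. -/
def compU (Φ : Jet0 → Jet0) (p : Jet0) : ℝ := (Φ p).2.2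

/-- The total Jacobian `D_t T · D_x X - D_x T · D_t X`. It is nonzero exactly at the jets of those
functions `u(t, x)` whose graph is locally mapped to the graph of a function `u'(t', x')`. -/
noncomputable def totalJac (Φ : Jet0 → Jet0) (z : Jet1) : ℝ :=
  totalT0 (compT Φ) z * totalX0 (compX Φ) z - totalX0 (compT Φ) z * totalT0 (compX Φ) z

/-- The transformed first derivative `u'_{t'} = (D_x X · D_t U - D_t X · D_x U) / Jac`. -/
noncomputable def newUt (Φ : Jet0 → Jet0) (z : Jet1) : ℝ :=
  (totalX0 (compX Φ) z * totalT0 (compU Φ) z - totalT0 (compX Φ) z * totalX0 (compU Φ) z) /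
    totalJac Φ z

/-- The transformed first derivative `u'_{x'} = (D_t T · D_x U - D_x T · D_t U) / Jac`. -/
noncomputable def newUx (Φ : Jet0 → Jet0) (z : Jet1) : ℝ :=
  (totalT0 (compT Φ) z * totalX0 (compU Φ) z - totalX0 (compT Φ) z * totalT0 (compU Φ) z) /
    totalJac Φ z

/-- The total derivative along `t'` of a function `G` on the first-order jet space:
`(D_x X · D_t G - D_t X · D_x G) / Jac`. -/
noncomputable def newDt (Φ : Jet0 → Jet0) (G : Jet1 → ℝ) (j : Jet2) : ℝ :=
  (totalX0 (compX Φ) j.toJet1 * totalT1 G j - totalT0 (compX Φ) j.toJet1 * totalX1 G j) /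
    totalJac Φ j.toJet1

/-- The total derivative along `x'` of a function `G` on the first-order jet space:
`(D_t T · D_x G - D_x T · D_t G) / Jac`. -/
noncomputable def newDx (Φ : Jet0 → Jet0) (G : Jet1 → ℝ) (j : Jet2) : ℝ :=
  (totalT0 (compT Φ) j.toJet1 * totalX1 G j - totalX0 (compT Φ) j.toJet1 * totalT1 G j) /
    totalJac Φ j.toJet1

/-- The second prolongation of a transformation of the variables `(t, x, u)`: the 2-jet of `u` is
sent to the 2-jet of the transformed function `u'`. It is meaningful where `totalJac Φ ≠ 0`. -/
noncomputable def prolong (Φ : Jet0 → Jet0) (j : Jet2) : Jet2 where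
  t := compT Φ j.base
  x := compX Φ j.base
  u := compU Φ j.base
  ut := newUt Φ j.toJet1
  ux := newUx Φ j.toJet1
  utt := newDt Φ (newUt Φ) j
  utx := newDt Φ (newUx Φ) j
  uxx := newDx Φ (newUx Φ) j

/-- A (nondegenerate) point transformation with domain `Ω`: a smooth diffeomorphism of the open
set `Ω` of the space of variables `(t, x, u)` onto its (open) image. -/
structure IsPointTransformation (Φ : Jet0 → Jet0) (Ω : Set Jet0) : Prop where
  smooth : ContDiffOn ℝ ∞ Φ Ω
  injOn : Set.InjOn Φ Ω
  det_ne_zero : ∀ p ∈ Ω, (fderiv ℝ Φ p).det ≠ 0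

/-- `Φ` maps the second-order equation `E` over `Ω` to the equation `E'`: wherever the prolongation
of `Φ` is defined over `Ω`, a 2-jet lies in `E` if and only if its image lies in `E'`. -/
def MapsEquation (Φ : Jet0 → Jet0) (Ω : Set Jet0) (E E' : Set Jet2) : Prop :=
  ∀ j : Jet2, j.base ∈ Ω → totalJac Φ j.toJet1 ≠ 0 → (j ∈ E ↔ prolong Φ j ∈ E')

/-- The equation with coefficients `a, b, c`, considered over `Ω`, is mapped by some point
transformation with domain `Ω` to an equation of the same class with constant coefficients
`A, B, C`, where `A` and `C` are nonzero. -/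
def ReducibleToConstant (a b c : ℝ → ℝ) (Ω : Set Jet0) : Prop :=
  ∃ (Φ : Jet0 → Jet0) (A B C : ℝ), A ≠ 0 ∧ C ≠ 0 ∧ IsPointTransformation Φ Ω ∧
    MapsEquation Φ Ω (equation a b c) (equation (fun _ => A) (fun _ => B) (fun _ => C))

end NWS

/-! If the transformed time `T` had `D_x T ≠ 0`, the image of a jet under the prolongation would
depend on `u_tt`, which the source equation leaves free; hence `T = T(t)`. Substituting `u_t` from
the source equation, the transformed equation becomes an identity in the remaining jet coordinates.
Comparing coefficients of `u_xx` gives `X_u = 0` and `a² X_x² = A² T_t`; comparing powers of `u_x`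
gives `U_uu = 0`; comparing powers of `u` then gives `X_t = 0`, `U = ψ u` with `ψ = U_u`,
`c = C T_t ψ²` and `ψ_t + b ψ = B T_t ψ`. For constant `A`, `B`, `C`, eliminating `T_t` and `ψ`
shows that the left-hand side of the criterion equals `B X_x² / A²`, which does not change with `t`.

Conversely, if it equals `lam`, the change of variables `(τ(t), x, ψ(t) u)` with `τ' = a²` and
`ψ' = (lam a² - b) ψ` makes `A = 1` and `B = lam`, while `c / a²` and `ψ²` have the same logarithmic
derivative, so that `C = c / (a² ψ²)` is constant. -/

namespace NWS

open Filter Topology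

section DirectionalDerivative

variable {E : Type*} [NormedAddCommGroup E] [NormedSpace ℝ E]

/-- The derivative of `F` in the direction `v`, as a function of the point; unlike `lineDeriv` it
takes the direction first, so that iterated derivatives read `dirDeriv v (dirDeriv w F)`. -/
noncomputable def dirDeriv (v : E) (F : E → ℝ) (p : E) : ℝ := fderiv ℝ F p v

theorem hasDerivAt_comp_add_smul {F : E → ℝ} {p v : E} {s : ℝ}
    (hF : DifferentiableAt ℝ F (p + s • v)) :
    HasDerivAt (fun r : ℝ => F (p + r • v)) (dirDeriv v F (p + s • v)) s := by
  have hline : HasDerivAt (fun r : ℝ => p + r • v) v s := by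
    simpa using ((hasDerivAt_id s).smul_const v).const_add p
  exact hF.hasFDerivAt.comp_hasDerivAt s hline

theorem hasDerivAt_comp_add_smul_zero {F : E → ℝ} {p : E} (hF : DifferentiableAt ℝ F p) (v : E) :
    HasDerivAt (fun r : ℝ => F (p + r • v)) (dirDeriv v F p) 0 :=
  hF.hasFDerivAt.hasLineDerivAt v

theorem dirDeriv_mul_sub_mul {f g h k : E → ℝ} {p : E} (hf : DifferentiableAt ℝ f p)
    (hg : DifferentiableAt ℝ g p) (hh : DifferentiableAt ℝ h p) (hk : DifferentiableAt ℝ k p)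
    (v : E) :
    dirDeriv v (fun q => f q * g q - h q * k q) p =
      (dirDeriv v f p * g p + f p * dirDeriv v g p) -
        (dirDeriv v h p * k p + h p * dirDeriv v k p) := by
  have hline := hasDerivAt_comp_add_smul_zero ((hf.fun_mul hg).fun_sub (hh.fun_mul hk)) v
  simpa using hline.unique (((hasDerivAt_comp_add_smul_zero hf v).mul
    (hasDerivAt_comp_add_smul_zero hg v)).sub ((hasDerivAt_comp_add_smul_zero hh v).mul
    (hasDerivAt_comp_add_smul_zero hk v)))

theorem dirDeriv_div {f g : E → ℝ} {p : E} (hf : DifferentiableAt ℝ f p)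
    (hg : DifferentiableAt ℝ g p) (h0 : g p ≠ 0) (v : E) :
    dirDeriv v (fun q => f q / g q) p =
      (dirDeriv v f p * g p - f p * dirDeriv v g p) / g p ^ 2 := by
  have hquot : DifferentiableAt ℝ (fun q => f q / g q) p := by
    simpa only [div_eq_mul_inv] using hf.fun_mul (hg.fun_inv h0)
  simpa using (hasDerivAt_comp_add_smul_zero hquot v).unique
    ((hasDerivAt_comp_add_smul_zero hf v).div (hasDerivAt_comp_add_smul_zero hg v)
      (by simpa using h0))

variable {Ω : Set E} {F : E → ℝ} {p : E}

theorem differentiableAt_of_contDiffOn {G : Type*} [NormedAddCommGroup G] [NormedSpace ℝ G]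
    {f : E → G} (hΩ : IsOpen Ω) (hf : ContDiffOn ℝ ∞ f Ω) (hp : p ∈ Ω) : DifferentiableAt ℝ f p :=
  (hf.differentiableOn (by simp)).differentiableAt (hΩ.mem_nhds hp)

theorem contDiffOn_dirDeriv (hΩ : IsOpen Ω) (hF : ContDiffOn ℝ ∞ F Ω) (v : E) :
    ContDiffOn ℝ ∞ (dirDeriv v F) Ω :=
  (hF.fderiv_of_isOpen hΩ (by simp)).clm_apply contDiffOn_const

theorem dirDeriv_comm (hΩ : IsOpen Ω) (hF : ContDiffOn ℝ ∞ F Ω) (hp : p ∈ Ω) (v w : E) :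
    dirDeriv v (dirDeriv w F) p = dirDeriv w (dirDeriv v F) p := by
  have hdiff : DifferentiableAt ℝ (fderiv ℝ F) p :=
    ((hF.fderiv_of_isOpen (m := ∞) hΩ (by simp)).differentiableOn (by simp)).differentiableAt
      (hΩ.mem_nhds hp)
  have hsecond (v w : E) : dirDeriv v (dirDeriv w F) p = fderiv ℝ (fderiv ℝ F) p v w := by
    simp [dirDeriv, fderiv_clm_apply hdiff (differentiableAt_const w),
      show dirDeriv w F = fun q => fderiv ℝ F q w from rfl]
  have hsymm : IsSymmSndFDerivAt ℝ F p :=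
    (hF.contDiffAt (hΩ.mem_nhds hp)).isSymmSndFDerivAt
      (by simpa using WithTop.coe_le_coe.2 (le_top : (2 : ℕ∞) ≤ ⊤))
  rw [hsecond, hsecond, hsymm.eq]

theorem dirDeriv_congr {G : E → ℝ} (hΩ : IsOpen Ω) (h : Set.EqOn F G Ω) (hp : p ∈ Ω) (v : E) :
    dirDeriv v F p = dirDeriv v G p := by
  rw [dirDeriv, dirDeriv, (h.eventuallyEq_of_mem (hΩ.mem_nhds hp)).fderiv_eq]

theorem dirDeriv_eq_zero_of_eqOn_const {k : ℝ} (hΩ : IsOpen Ω) (h : ∀ q ∈ Ω, F q = k)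
    (hp : p ∈ Ω) (v : E) : dirDeriv v F p = 0 := by
  rw [dirDeriv_congr (G := fun _ => k) hΩ h hp, dirDeriv, fderiv_const_apply, zero_apply]

theorem dirDeriv_dirDeriv_dirDeriv_eq_zero (hΩ : IsOpen Ω) (hF : ContDiffOn ℝ ∞ F Ω) {v : E}
    (h : ∀ q ∈ Ω, dirDeriv v (dirDeriv v F) q = 0) (hp : p ∈ Ω) (w : E) :
    dirDeriv v (dirDeriv v (dirDeriv w F)) p = 0 := by
  rw [dirDeriv_congr hΩ (fun q hq => dirDeriv_comm hΩ hF hq v w) hp,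
    dirDeriv_comm hΩ (contDiffOn_dirDeriv hΩ hF v) hp,
    dirDeriv_eq_zero_of_eqOn_const hΩ h hp]

theorem eventually_add_smul_mem (hΩ : IsOpen Ω) (hp : p ∈ Ω) (v : E) :
    ∀ᶠ s : ℝ in 𝓝 0, p + s • v ∈ Ω := by
  have hcont : ContinuousAt (fun s : ℝ => p + s • v) 0 := by fun_prop
  exact hcont.eventually_mem (hΩ.mem_nhds (by simpa using hp))

theorem eventually_eq_of_hasDerivAt_zero {f : ℝ → ℝ} {r : ℝ}
    (h : ∀ᶠ s in 𝓝 r, HasDerivAt f 0 s) : ∀ᶠ s in 𝓝 r, f s = f r := by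
  obtain ⟨ε, hε, hball⟩ := Metric.eventually_nhds_iff_ball.1 h
  filter_upwards [Metric.ball_mem_nhds r hε] with s hs
  exact Metric.isOpen_ball.is_const_of_deriv_eq_zero (convex_ball r ε).isPreconnected
    (fun q hq => (hball q hq).differentiableAt.differentiableWithinAt)
    (fun q hq => (hball q hq).deriv) hs (Metric.mem_ball_self hε)

theorem eventually_eq_of_dirDeriv_eq_zero (hΩ : IsOpen Ω) (hF : ContDiffOn ℝ ∞ F Ω) {v : E}
    (h : ∀ q ∈ Ω, dirDeriv v F q = 0) (hp : p ∈ Ω) : ∀ᶠ s : ℝ in 𝓝 0, F (p + s • v) = F p := by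
  have hderiv : ∀ᶠ s : ℝ in 𝓝 0, HasDerivAt (fun r : ℝ => F (p + r • v)) 0 s := by
    filter_upwards [eventually_add_smul_mem hΩ hp v] with s hs
    simpa only [h _ hs] using hasDerivAt_comp_add_smul (differentiableAt_of_contDiffOn hΩ hF hs)
  simpa using eventually_eq_of_hasDerivAt_zero hderiv

theorem eventually_eq_add_mul_dirDeriv (hΩ : IsOpen Ω) (hF : ContDiffOn ℝ ∞ F Ω) {v : E}
    (h : ∀ q ∈ Ω, dirDeriv v (dirDeriv v F) q = 0) (hp : p ∈ Ω) :
    ∀ᶠ s : ℝ in 𝓝 0, F (p + s • v) = F p + s * dirDeriv v F p := by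
  have hderiv : ∀ᶠ s : ℝ in 𝓝 0,
      HasDerivAt (fun r : ℝ => F (p + r • v) - r * dirDeriv v F p) 0 s := by
    filter_upwards [eventually_add_smul_mem hΩ hp v,
      eventually_eq_of_dirDeriv_eq_zero hΩ (contDiffOn_dirDeriv hΩ hF v) h hp] with s hs hconst
    simpa [hconst] using
      (hasDerivAt_comp_add_smul (differentiableAt_of_contDiffOn hΩ hF hs)).fun_sub
        ((hasDerivAt_id s).mul_const (dirDeriv v F p))
  filter_upwards [eventually_eq_of_hasDerivAt_zero hderiv] with s hs
  simpa [sub_eq_iff_eq_add] using hs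

theorem dirDeriv_eq_zero_of_eventually_mul_sq_eq (hF : DifferentiableAt ℝ F p) (h0 : F p ≠ 0)
    {k l : ℝ} (hk : k ≠ 0) {v : E} (h : ∀ᶠ s : ℝ in 𝓝 0, k * F (p + s • v) ^ 2 = l) :
    dirDeriv v F p = 0 := by
  have hsq := ((hasDerivAt_comp_add_smul_zero hF v).fun_pow 2).const_mul k
  have hzero := hsq.unique ((hasDerivAt_const (0 : ℝ) l).congr_of_eventuallyEq h)
  simpa [hk, h0] using hzero

end DirectionalDerivative

theorem cubic_coeffs_eq_zero_of_eventually {k₀ k₁ k₂ k₃ : ℝ}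
    (h : ∀ᶠ s in 𝓝 (0 : ℝ), k₃ * s ^ 3 + k₂ * s ^ 2 + k₁ * s + k₀ = 0) :
    k₃ = 0 ∧ k₂ = 0 ∧ k₁ = 0 ∧ k₀ = 0 := by
  have hzero : (Cubic.mk k₃ k₂ k₁ k₀).toPoly = 0 := by
    refine Polynomial.eq_zero_of_infinite_isRoot _ ((infinite_of_mem_nhds 0 h).mono fun s hs => ?_)
    simpa [Cubic.toPoly] using hs
  have heq := hzero.trans Cubic.zero.symm
  exact ⟨Cubic.a_of_eq heq, Cubic.b_of_eq heq, Cubic.c_of_eq heq, Cubic.d_of_eq heq⟩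

local notation "∂ₜ" => dirDeriv ((1, 0, 0) : Jet0)
local notation "∂ₓ" => dirDeriv ((0, 1, 0) : Jet0)
local notation "∂ᵤ" => dirDeriv ((0, 0, 1) : Jet0)

section Jets

theorem dirDeriv_mk (F : Jet0 → ℝ) (p : Jet0) (α β γ : ℝ) :
    dirDeriv (α, β, γ) F p = α * ∂ₜ F p + β * ∂ₓ F p + γ * ∂ᵤ F p := by
  have hv : ((α, β, γ) : Jet0) = α • (1, 0, 0) + β • (0, 1, 0) + γ • (0, 0, 1) := by simp
  simp only [dirDeriv, hv, map_add, map_smul, smul_eq_mul]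

theorem totalT0_eq (F : Jet0 → ℝ) (z : Jet1) : totalT0 F z = ∂ₜ F z.1 + z.2.1 * ∂ᵤ F z.1 :=
  (dirDeriv_mk F z.1 1 0 z.2.1).trans (by ring)

theorem totalX0_eq (F : Jet0 → ℝ) (z : Jet1) : totalX0 F z = ∂ₓ F z.1 + z.2.2 * ∂ᵤ F z.1 :=
  (dirDeriv_mk F z.1 0 1 z.2.2).trans (by ring)

theorem differentiableAt_add_mul_comp_fst {G H : Jet0 → ℝ} {z : Jet1}
    (hG : DifferentiableAt ℝ G z.1) (hH : DifferentiableAt ℝ H z.1) (ℓ : Jet1 →L[ℝ] ℝ) :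
    DifferentiableAt ℝ (fun y => G y.1 + ℓ y * H y.1) z :=
  (hG.comp z differentiableAt_fst).fun_add
    (ℓ.differentiableAt.fun_mul (hH.comp z differentiableAt_fst))

theorem dirDeriv_add_mul_comp_fst {G H : Jet0 → ℝ} {z : Jet1}
    (hG : DifferentiableAt ℝ G z.1) (hH : DifferentiableAt ℝ H z.1) (ℓ : Jet1 →L[ℝ] ℝ) (v : Jet1) :
    dirDeriv v (fun y => G y.1 + ℓ y * H y.1) z =
      dirDeriv v.1 G z.1 + (ℓ v * H z.1 + ℓ z * dirDeriv v.1 H z.1) := by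
  have hℓ := hasDerivAt_comp_add_smul_zero (ℓ.differentiableAt (x := z)) v
  have hline := (hasDerivAt_comp_add_smul_zero hG v.1).fun_add
    (hℓ.fun_mul (hasDerivAt_comp_add_smul_zero hH v.1))
  simpa [dirDeriv] using
    (hasDerivAt_comp_add_smul_zero (differentiableAt_add_mul_comp_fst hG hH ℓ) v).unique hline

variable {Ω : Set Jet0} {F : Jet0 → ℝ} {z : Jet1}

theorem differentiableAt_totalT0 (hΩ : IsOpen Ω) (hF : ContDiffOn ℝ ∞ F Ω) (hz : z.1 ∈ Ω) :
    DifferentiableAt ℝ (totalT0 F) z := by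
  rw [funext (totalT0_eq F)]
  exact differentiableAt_add_mul_comp_fst
    (differentiableAt_of_contDiffOn hΩ (contDiffOn_dirDeriv hΩ hF _) hz)
    (differentiableAt_of_contDiffOn hΩ (contDiffOn_dirDeriv hΩ hF _) hz)
    ((ContinuousLinearMap.fst ℝ ℝ ℝ).comp (ContinuousLinearMap.snd ℝ Jet0 (ℝ × ℝ)))

theorem differentiableAt_totalX0 (hΩ : IsOpen Ω) (hF : ContDiffOn ℝ ∞ F Ω) (hz : z.1 ∈ Ω) :
    DifferentiableAt ℝ (totalX0 F) z := by
  rw [funext (totalX0_eq F)]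
  exact differentiableAt_add_mul_comp_fst
    (differentiableAt_of_contDiffOn hΩ (contDiffOn_dirDeriv hΩ hF _) hz)
    (differentiableAt_of_contDiffOn hΩ (contDiffOn_dirDeriv hΩ hF _) hz)
    ((ContinuousLinearMap.snd ℝ ℝ ℝ).comp (ContinuousLinearMap.snd ℝ Jet0 (ℝ × ℝ)))

theorem dirDeriv_totalT0 (hΩ : IsOpen Ω) (hF : ContDiffOn ℝ ∞ F Ω) (hz : z.1 ∈ Ω) (v : Jet1) :
    dirDeriv v (totalT0 F) z =
      dirDeriv v.1 (∂ₜ F) z.1 + (v.2.1 * ∂ᵤ F z.1 + z.2.1 * dirDeriv v.1 (∂ᵤ F) z.1) := by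
  rw [funext (totalT0_eq F)]
  exact dirDeriv_add_mul_comp_fst
    (differentiableAt_of_contDiffOn hΩ (contDiffOn_dirDeriv hΩ hF _) hz)
    (differentiableAt_of_contDiffOn hΩ (contDiffOn_dirDeriv hΩ hF _) hz)
    ((ContinuousLinearMap.fst ℝ ℝ ℝ).comp (ContinuousLinearMap.snd ℝ Jet0 (ℝ × ℝ))) v

theorem dirDeriv_totalX0 (hΩ : IsOpen Ω) (hF : ContDiffOn ℝ ∞ F Ω) (hz : z.1 ∈ Ω) (v : Jet1) :
    dirDeriv v (totalX0 F) z =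
      dirDeriv v.1 (∂ₓ F) z.1 + (v.2.2 * ∂ᵤ F z.1 + z.2.2 * dirDeriv v.1 (∂ᵤ F) z.1) := by
  rw [funext (totalX0_eq F)]
  exact dirDeriv_add_mul_comp_fst
    (differentiableAt_of_contDiffOn hΩ (contDiffOn_dirDeriv hΩ hF _) hz)
    (differentiableAt_of_contDiffOn hΩ (contDiffOn_dirDeriv hΩ hF _) hz)
    ((ContinuousLinearMap.snd ℝ ℝ ℝ).comp (ContinuousLinearMap.snd ℝ Jet0 (ℝ × ℝ))) v

theorem totalX1_totalX0 (hΩ : IsOpen Ω) (hF : ContDiffOn ℝ ∞ F Ω) {j : Jet2} (hj : j.base ∈ Ω) :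
    totalX1 (totalX0 F) j = ∂ₓ (∂ₓ F) j.base + 2 * j.ux * ∂ₓ (∂ᵤ F) j.base +
      j.ux ^ 2 * ∂ᵤ (∂ᵤ F) j.base + j.uxx * ∂ᵤ F j.base := by
  have hX := dirDeriv_totalX0 (z := j.toJet1) hΩ hF hj ((0, 1, j.ux), (j.utx, j.uxx))
  have hcomm := dirDeriv_comm hΩ hF hj (0, 0, 1) (0, 1, 0)
  rw [dirDeriv_mk _ _ 0 1 j.ux, dirDeriv_mk _ _ 0 1 j.ux] at hX
  refine hX.trans ?_
  simp only [Jet2.toJet1, Jet2.base] at hcomm ⊢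
  rw [hcomm]
  ring

end Jets

section Components

variable {Φ : Jet0 → Jet0} {Ω : Set Jet0}

theorem IsPointTransformation.contDiffOn_compT (h : IsPointTransformation Φ Ω) :
    ContDiffOn ℝ ∞ (compT Φ) Ω := h.smooth.fst

theorem IsPointTransformation.contDiffOn_compX (h : IsPointTransformation Φ Ω) :
    ContDiffOn ℝ ∞ (compX Φ) Ω := h.smooth.snd.fst

theorem IsPointTransformation.contDiffOn_compU (h : IsPointTransformation Φ Ω) :
    ContDiffOn ℝ ∞ (compU Φ) Ω := h.smooth.snd.snd

theorem fderiv_apply_components {p : Jet0} (hΦ : DifferentiableAt ℝ Φ p) (v : Jet0) :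
    fderiv ℝ Φ p v = (dirDeriv v (compT Φ) p, dirDeriv v (compX Φ) p, dirDeriv v (compU Φ) p) := by
  have hT : HasFDerivAt (compT Φ) _ p := hΦ.hasFDerivAt.fst
  have hX : HasFDerivAt (compX Φ) _ p := hΦ.hasFDerivAt.snd.fst
  have hU : HasFDerivAt (compU Φ) _ p := hΦ.hasFDerivAt.snd.snd
  rw [dirDeriv, dirDeriv, dirDeriv, hT.fderiv, hX.fderiv, hU.fderiv]
  rfl

theorem det_fderiv_eq {p : Jet0} (hΦ : DifferentiableAt ℝ Φ p) :
    (fderiv ℝ Φ p).det = Matrix.det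
      !![∂ₜ (compT Φ) p, ∂ₓ (compT Φ) p, ∂ᵤ (compT Φ) p;
        ∂ₜ (compX Φ) p, ∂ₓ (compX Φ) p, ∂ᵤ (compX Φ) p;
        ∂ₜ (compU Φ) p, ∂ₓ (compU Φ) p, ∂ᵤ (compU Φ) p] := by
  let coords : Jet0 ≃ₗ[ℝ] (Fin 3 → ℝ) :=
    { toFun := fun p => ![p.1, p.2.1, p.2.2]
      invFun := fun w => (w 0, w 1, w 2)
      map_add' := fun p q => by simp
      map_smul' := fun r p => by simp
      left_inv := fun p => rfl
      right_inv := fun w => by ext i; fin_cases i <;> rfl }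
  have hcoords (q : Jet0) : coords q = ![q.1, q.2.1, q.2.2] := rfl
  have hsymm (w : Fin 3 → ℝ) : coords.symm w = (w 0, w 1, w 2) := rfl
  rw [ContinuousLinearMap.det, ← LinearMap.det_toMatrix (Module.Basis.ofEquivFun coords)]
  congr 1
  ext i k
  fin_cases i <;> fin_cases k <;>
    simp [LinearMap.toMatrix_apply, hcoords, hsymm, fderiv_apply_components hΦ]

end Components

section TimeComponent

variable {Φ : Jet0 → Jet0} {Ω : Set Jet0} {a b c A B C : ℝ → ℝ}

/-- An admissible transformation of the class `u_t = a² u_xx + b u - c u³`: a point transformation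
over an open set, a source equation with coefficients `a, b, c` and a target equation with
coefficients `A, B, C`, both with nonvanishing diffusion. The target is allowed to depend on time,
since the necessary conditions do not see the difference. -/
structure IsAdmissible (Φ : Jet0 → Jet0) (Ω : Set Jet0) (a b c A B C : ℝ → ℝ) : Prop where
  isOpen : IsOpen Ω
  isPointTransformation : IsPointTransformation Φ Ω
  mapsEquation : MapsEquation Φ Ω (equation a b c) (equation A B C)
  source_ne_zero : ∀ p ∈ Ω, a p.1 ≠ 0
  target_ne_zero : ∀ p ∈ Ω, A (compT Φ p) ≠ 0

theorem IsPointTransformation.dirDeriv_newUx_ut (h : IsPointTransformation Φ Ω) (hΩ : IsOpen Ω)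
    {z : Jet1} (hz : z.1 ∈ Ω) (hJ : totalJac Φ z ≠ 0) :
    dirDeriv (0, (1, 0)) (newUx Φ) z =
      -(totalX0 (compT Φ) z * (fderiv ℝ Φ z.1).det) / totalJac Φ z ^ 2 := by
  have hdT {F} (hF : ContDiffOn ℝ ∞ F Ω) : DifferentiableAt ℝ (totalT0 F) z :=
    differentiableAt_totalT0 hΩ hF hz
  have hdX {F} (hF : ContDiffOn ℝ ∞ F Ω) : DifferentiableAt ℝ (totalX0 F) z :=
    differentiableAt_totalX0 hΩ hF hz
  have hnum := dirDeriv_mul_sub_mul (hdT h.contDiffOn_compT) (hdX h.contDiffOn_compU)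
    (hdX h.contDiffOn_compT) (hdT h.contDiffOn_compU) (0, (1, 0))
  have hden := dirDeriv_mul_sub_mul (hdT h.contDiffOn_compT) (hdX h.contDiffOn_compX)
    (hdX h.contDiffOn_compT) (hdT h.contDiffOn_compX) (0, (1, 0))
  have hquot := dirDeriv_div
    (((hdT h.contDiffOn_compT).fun_mul (hdX h.contDiffOn_compU)).fun_sub
      ((hdX h.contDiffOn_compT).fun_mul (hdT h.contDiffOn_compU)))
    (((hdT h.contDiffOn_compT).fun_mul (hdX h.contDiffOn_compX)).fun_sub
      ((hdX h.contDiffOn_compT).fun_mul (hdT h.contDiffOn_compX))) hJ (0, (1, 0))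
  refine hquot.trans ?_
  have hzero (F : Jet0 → ℝ) : dirDeriv 0 F z.1 = 0 := map_zero _
  rw [hnum, hden, det_fderiv_eq (differentiableAt_of_contDiffOn hΩ h.smooth hz),
    Matrix.det_fin_three]
  simp only [dirDeriv_totalT0 hΩ h.contDiffOn_compT hz, dirDeriv_totalT0 hΩ h.contDiffOn_compX hz,
    dirDeriv_totalT0 hΩ h.contDiffOn_compU hz, dirDeriv_totalX0 hΩ h.contDiffOn_compT hz,
    dirDeriv_totalX0 hΩ h.contDiffOn_compX hz, dirDeriv_totalX0 hΩ h.contDiffOn_compU hz, hzero,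
    totalJac, totalT0_eq, totalX0_eq, Matrix.of_apply, Matrix.cons_val]
  congr 1
  ring

theorem newDx_update_utt (G : Jet1 → ℝ) (j : Jet2) (s : ℝ) :
    newDx Φ G { j with utt := j.utt + s } = newDx Φ G j -
      s * (totalX0 (compT Φ) j.toJet1 * dirDeriv (0, (1, 0)) G j.toJet1 / totalJac Φ j.toJet1) := by
  have hT : totalT1 G { j with utt := j.utt + s } =
      totalT1 G j + s * dirDeriv (0, (1, 0)) G j.toJet1 := by
    have hdir : (((1, 0, j.ut), (j.utt + s, j.utx)) : Jet1) =
        ((1, 0, j.ut), (j.utt, j.utx)) + s • (0, (1, 0)) := by simp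
    simp only [totalT1, Jet2.toJet1, dirDeriv, hdir, map_add, map_smul, smul_eq_mul]
  simp only [newDx, hT]
  simp only [totalX1, Jet2.toJet1]
  ring

theorem slope_eq_zero_of_forall_iff {P : Prop} {k l m : ℝ} (h : ∀ s, P ↔ k = l + s * m) :
    m = 0 := by
  by_contra hm
  have hroot : k = l + (k - l) / m * m := by rw [div_mul_cancel₀ _ hm, add_sub_cancel]
  have hnext := (h ((k - l) / m + 1)).1 ((h _).2 hroot)
  exact hm (by linear_combination hroot - hnext)

-- If `D_x T ≠ 0`, the target equation involves `u_tt`, which the source equation leaves free.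
theorem IsAdmissible.totalX0_compT_eq_zero (h : IsAdmissible Φ Ω a b c A B C) {z : Jet1}
    (hz : z.1 ∈ Ω) (hJ : totalJac Φ z ≠ 0) : totalX0 (compT Φ) z = 0 := by
  let j : Jet2 := ⟨z.1.1, z.1.2.1, z.1.2.2, z.2.1, z.2.2, 0, 0, 0⟩
  set κ := totalX0 (compT Φ) z * dirDeriv (0, (1, 0)) (newUx Φ) z / totalJac Φ z with hκ
  have hmem (s : ℝ) : j ∈ equation a b c ↔
      newUt Φ z = (A (compT Φ z.1) ^ 2 * newDx Φ (newUx Φ) j + B (compT Φ z.1) * compU Φ z.1 -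
        C (compT Φ z.1) * compU Φ z.1 ^ 3) + s * -(A (compT Φ z.1) ^ 2 * κ) := by
    have huxx : (prolong Φ { j with utt := j.utt + s }).uxx = newDx Φ (newUx Φ) j - s * κ :=
      newDx_update_utt (newUx Φ) j s
    have hiff : j ∈ equation a b c ↔ newUt Φ z =
        A (compT Φ z.1) ^ 2 * (prolong Φ { j with utt := j.utt + s }).uxx +
          B (compT Φ z.1) * compU Φ z.1 - C (compT Φ z.1) * compU Φ z.1 ^ 3 :=
      h.mapsEquation { j with utt := j.utt + s } hz hJ
    rw [hiff, huxx]
    ring_nf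
  have hslope := slope_eq_zero_of_forall_iff hmem
  rw [hκ, h.isPointTransformation.dirDeriv_newUx_ut h.isOpen hz hJ] at hslope
  simpa [h.target_ne_zero z.1 hz, h.isPointTransformation.det_ne_zero z.1 hz, hJ] using hslope

theorem coeffs_eq_zero_of_mul_eq_zero {α β γ δ ε : ℝ}
    (h : ∀ r s : ℝ, (α + r * β) * (γ + s * δ + r * ε) = 0) :
    (α = 0 ∧ β = 0) ∨ (γ = 0 ∧ δ = 0 ∧ ε = 0) := by
  have h00 := h 0 0
  have h01 := h 0 1
  have h10 := h 1 0
  have h11 := h 1 1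
  have hn0 := h (-1) 0
  by_cases hα : α = 0
  · by_cases hβ : β = 0
    · exact Or.inl ⟨hα, hβ⟩
    · grind
  · grind

/-- The transformed time depends on `t` alone over `Ω`, infinitesimally: `T_x = T_u = 0`. -/
def TimeProjectable (Φ : Jet0 → Jet0) (Ω : Set Jet0) : Prop :=
  ∀ p ∈ Ω, ∂ₓ (compT Φ) p = 0 ∧ ∂ᵤ (compT Φ) p = 0

theorem IsAdmissible.timeProjectable (h : IsAdmissible Φ Ω a b c A B C) :
    TimeProjectable Φ Ω := by
  intro p hp
  have hprod (r s : ℝ) : (∂ₓ (compT Φ) p + r * ∂ᵤ (compT Φ) p) *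
      ((∂ₜ (compT Φ) p * ∂ₓ (compX Φ) p - ∂ₓ (compT Φ) p * ∂ₜ (compX Φ) p) +
        s * (∂ᵤ (compT Φ) p * ∂ₓ (compX Φ) p - ∂ₓ (compT Φ) p * ∂ᵤ (compX Φ) p) +
        r * (∂ₜ (compT Φ) p * ∂ᵤ (compX Φ) p - ∂ᵤ (compT Φ) p * ∂ₜ (compX Φ) p)) = 0 := by
    have hzero : totalX0 (compT Φ) (p, (s, r)) * totalJac Φ (p, (s, r)) = 0 := by
      by_cases hJ : totalJac Φ (p, (s, r)) = 0
      · rw [hJ, mul_zero]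
      · rw [h.totalX0_compT_eq_zero hp hJ, zero_mul]
    simp only [totalJac, totalT0_eq, totalX0_eq] at hzero
    linear_combination hzero
  refine (coeffs_eq_zero_of_mul_eq_zero hprod).resolve_right fun ⟨htx, hux, htu⟩ => ?_
  refine h.isPointTransformation.det_ne_zero p hp ?_
  rw [det_fderiv_eq (differentiableAt_of_contDiffOn h.isOpen h.isPointTransformation.smooth hp),
    Matrix.det_fin_three]
  simp only [Matrix.of_apply, Matrix.cons_val]
  linear_combination ∂ᵤ (compU Φ) p * htx - ∂ₓ (compU Φ) p * htu - ∂ₜ (compU Φ) p * hux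

end TimeComponent

section TimeProjectable

variable {Φ : Jet0 → Jet0} {Ω : Set Jet0} {A B C : ℝ → ℝ}

theorem TimeProjectable.det_fderiv_eq (hT : TimeProjectable Φ Ω) {p : Jet0} (hp : p ∈ Ω)
    (hΦ : DifferentiableAt ℝ Φ p) :
    (fderiv ℝ Φ p).det = ∂ₜ (compT Φ) p *
      (∂ₓ (compX Φ) p * ∂ᵤ (compU Φ) p - ∂ᵤ (compX Φ) p * ∂ₓ (compU Φ) p) := by
  rw [NWS.det_fderiv_eq hΦ, Matrix.det_fin_three]
  simp only [Matrix.of_apply, Matrix.cons_val, (hT p hp).1, (hT p hp).2]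
  ring

theorem TimeProjectable.totalT0_compT (hT : TimeProjectable Φ Ω) {z : Jet1} (hz : z.1 ∈ Ω) :
    totalT0 (compT Φ) z = ∂ₜ (compT Φ) z.1 := by
  rw [totalT0_eq, (hT z.1 hz).2, mul_zero, add_zero]

theorem TimeProjectable.totalX0_compT (hT : TimeProjectable Φ Ω) {z : Jet1} (hz : z.1 ∈ Ω) :
    totalX0 (compT Φ) z = 0 := by
  rw [totalX0_eq, (hT z.1 hz).1, (hT z.1 hz).2, mul_zero, add_zero]

theorem TimeProjectable.totalJac_eq (hT : TimeProjectable Φ Ω) {z : Jet1} (hz : z.1 ∈ Ω) :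
    totalJac Φ z = ∂ₜ (compT Φ) z.1 * totalX0 (compX Φ) z := by
  rw [totalJac, hT.totalT0_compT hz, hT.totalX0_compT hz, zero_mul, sub_zero]

theorem TimeProjectable.newUx_eq (hT : TimeProjectable Φ Ω) {z : Jet1} (hz : z.1 ∈ Ω)
    (hTt : ∂ₜ (compT Φ) z.1 ≠ 0) : newUx Φ z = totalX0 (compU Φ) z / totalX0 (compX Φ) z := by
  rw [newUx, hT.totalJac_eq hz, hT.totalT0_compT hz, hT.totalX0_compT hz, zero_mul, sub_zero,
    mul_div_mul_left _ _ hTt]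

section

variable (hΩ : IsOpen Ω) (h : IsPointTransformation Φ Ω) (hT : TimeProjectable Φ Ω)
include hΩ h hT

theorem IsPointTransformation.compT_t_ne_zero {p : Jet0} (hp : p ∈ Ω) :
    ∂ₜ (compT Φ) p ≠ 0 := by
  have hdet := h.det_ne_zero p hp
  rw [hT.det_fderiv_eq hp (differentiableAt_of_contDiffOn hΩ h.smooth hp)] at hdet
  exact left_ne_zero_of_mul hdet

theorem IsPointTransformation.spaceMinor_ne_zero {p : Jet0} (hp : p ∈ Ω) :
    ∂ₓ (compX Φ) p * ∂ᵤ (compU Φ) p - ∂ᵤ (compX Φ) p * ∂ₓ (compU Φ) p ≠ 0 := by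
  have hdet := h.det_ne_zero p hp
  rw [hT.det_fderiv_eq hp (differentiableAt_of_contDiffOn hΩ h.smooth hp)] at hdet
  exact right_ne_zero_of_mul hdet

theorem IsPointTransformation.newDx_newUx {j : Jet2} (hj : j.base ∈ Ω)
    (hX : totalX0 (compX Φ) j.toJet1 ≠ 0) :
    newDx Φ (newUx Φ) j =
      (totalX1 (totalX0 (compU Φ)) j * totalX0 (compX Φ) j.toJet1 -
        totalX0 (compU Φ) j.toJet1 * totalX1 (totalX0 (compX Φ)) j) /
          totalX0 (compX Φ) j.toJet1 ^ 3 := by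
  have hTt : ∂ₜ (compT Φ) j.toJet1.1 ≠ 0 := h.compT_t_ne_zero hΩ hT hj
  have hquot : totalX1 (newUx Φ) j =
      (totalX1 (totalX0 (compU Φ)) j * totalX0 (compX Φ) j.toJet1 -
        totalX0 (compU Φ) j.toJet1 * totalX1 (totalX0 (compX Φ)) j) /
          totalX0 (compX Φ) j.toJet1 ^ 2 :=
    (dirDeriv_congr (hΩ.preimage continuous_fst)
      (fun z hz => hT.newUx_eq hz (h.compT_t_ne_zero hΩ hT hz)) hj _).trans
      (dirDeriv_div (differentiableAt_totalX0 hΩ h.contDiffOn_compU hj)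
        (differentiableAt_totalX0 hΩ h.contDiffOn_compX hj) hX _)
  rw [newDx, hT.totalJac_eq hj, hT.totalT0_compT hj, hT.totalX0_compT hj, zero_mul, sub_zero,
    mul_div_mul_left _ _ hTt, hquot, div_div, ← pow_succ]

theorem IsPointTransformation.prolong_mem_equation_iff {j : Jet2} (hj : j.base ∈ Ω)
    (hX : totalX0 (compX Φ) j.toJet1 ≠ 0) :
    prolong Φ j ∈ equation A B C ↔
      totalX0 (compX Φ) j.toJet1 ^ 2 *
          (totalX0 (compX Φ) j.toJet1 * totalT0 (compU Φ) j.toJet1 -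
            totalT0 (compX Φ) j.toJet1 * totalX0 (compU Φ) j.toJet1) =
        A (compT Φ j.base) ^ 2 * ∂ₜ (compT Φ) j.base *
          (totalX1 (totalX0 (compU Φ)) j * totalX0 (compX Φ) j.toJet1 -
            totalX0 (compU Φ) j.toJet1 * totalX1 (totalX0 (compX Φ)) j) +
        (B (compT Φ j.base) * compU Φ j.base - C (compT Φ j.base) * compU Φ j.base ^ 3) *
          ∂ₜ (compT Φ) j.base * totalX0 (compX Φ) j.toJet1 ^ 3 := by
  have hTt := h.compT_t_ne_zero hΩ hT hj
  have hbase : j.toJet1.1 = j.base := rfl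
  change newUt Φ j.toJet1 = A (compT Φ j.base) ^ 2 * newDx Φ (newUx Φ) j +
    B (compT Φ j.base) * compU Φ j.base - C (compT Φ j.base) * compU Φ j.base ^ 3 ↔ _
  rw [h.newDx_newUx hΩ hT hj hX, newUt, hT.totalJac_eq hj, hbase]
  field_simp
  constructor <;> intro heq <;> linear_combination heq

end

end TimeProjectable

namespace IsAdmissible

variable {Φ : Jet0 → Jet0} {Ω : Set Jet0} {a b c A B C : ℝ → ℝ} {p : Jet0}

section

variable (h : IsAdmissible Φ Ω a b c A B C)
include h

theorem contDiffOn_compT : ContDiffOn ℝ ∞ (compT Φ) Ω := h.isPointTransformation.contDiffOn_compT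

theorem contDiffOn_compX : ContDiffOn ℝ ∞ (compX Φ) Ω := h.isPointTransformation.contDiffOn_compX

theorem contDiffOn_compU : ContDiffOn ℝ ∞ (compU Φ) Ω := h.isPointTransformation.contDiffOn_compU

theorem compT_t_ne_zero (hp : p ∈ Ω) : ∂ₜ (compT Φ) p ≠ 0 :=
  h.isPointTransformation.compT_t_ne_zero h.isOpen h.timeProjectable hp

theorem determining_identity (hp : p ∈ Ω) {r : ℝ} (hr : ∂ₓ (compX Φ) p + r * ∂ᵤ (compX Φ) p ≠ 0)
    (w : ℝ) :
    (∂ₓ (compX Φ) p + r * ∂ᵤ (compX Φ) p) ^ 2 *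
        ((∂ₓ (compX Φ) p + r * ∂ᵤ (compX Φ) p) * (∂ₜ (compU Φ) p +
            (a p.1 ^ 2 * w + b p.1 * p.2.2 - c p.1 * p.2.2 ^ 3) * ∂ᵤ (compU Φ) p) -
          (∂ₜ (compX Φ) p + (a p.1 ^ 2 * w + b p.1 * p.2.2 - c p.1 * p.2.2 ^ 3) *
            ∂ᵤ (compX Φ) p) * (∂ₓ (compU Φ) p + r * ∂ᵤ (compU Φ) p)) =
      A (compT Φ p) ^ 2 * ∂ₜ (compT Φ) p *
        ((∂ₓ (∂ₓ (compU Φ)) p + 2 * r * ∂ₓ (∂ᵤ (compU Φ)) p + r ^ 2 * ∂ᵤ (∂ᵤ (compU Φ)) p +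
            w * ∂ᵤ (compU Φ) p) * (∂ₓ (compX Φ) p + r * ∂ᵤ (compX Φ) p) -
          (∂ₓ (compU Φ) p + r * ∂ᵤ (compU Φ) p) *
            (∂ₓ (∂ₓ (compX Φ)) p + 2 * r * ∂ₓ (∂ᵤ (compX Φ)) p + r ^ 2 * ∂ᵤ (∂ᵤ (compX Φ)) p +
              w * ∂ᵤ (compX Φ) p)) +
      (B (compT Φ p) * compU Φ p - C (compT Φ p) * compU Φ p ^ 3) * ∂ₜ (compT Φ) p *
        (∂ₓ (compX Φ) p + r * ∂ᵤ (compX Φ) p) ^ 3 := by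
  let j : Jet2 := ⟨p.1, p.2.1, p.2.2, a p.1 ^ 2 * w + b p.1 * p.2.2 - c p.1 * p.2.2 ^ 3, r, 0, 0, w⟩
  have hj : j.base ∈ Ω := hp
  have hX : totalX0 (compX Φ) j.toJet1 ≠ 0 := by rwa [totalX0_eq]
  have hJ : totalJac Φ j.toJet1 ≠ 0 := by
    rw [h.timeProjectable.totalJac_eq hp]
    exact mul_ne_zero (h.compT_t_ne_zero hp) hX
  have himage := (h.mapsEquation j hp hJ).1 rfl
  rw [h.isPointTransformation.prolong_mem_equation_iff h.isOpen h.timeProjectable hj hX,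
    totalX1_totalX0 h.isOpen h.contDiffOn_compU hj,
    totalX1_totalX0 h.isOpen h.contDiffOn_compX hj] at himage
  simp only [totalT0_eq, totalX0_eq] at himage
  exact himage

-- Both sides of the determining identity are affine in `u_xx`; these are the slopes, divided by
-- the minor `X_x U_u - X_u U_x`.
theorem sq_mul_sq_totalX0_compX (hp : p ∈ Ω) {r : ℝ}
    (hr : ∂ₓ (compX Φ) p + r * ∂ᵤ (compX Φ) p ≠ 0) :
    a p.1 ^ 2 * (∂ₓ (compX Φ) p + r * ∂ᵤ (compX Φ) p) ^ 2 =
      A (compT Φ p) ^ 2 * ∂ₜ (compT Φ) p := by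
  have hminor := h.isPointTransformation.spaceMinor_ne_zero h.isOpen h.timeProjectable hp
  refine mul_right_cancel₀ hminor ?_
  linear_combination h.determining_identity hp hr 1 - h.determining_identity hp hr 0

theorem compX_u_eq_zero (hp : p ∈ Ω) : ∂ᵤ (compX Φ) p = 0 := by
  by_contra hXu
  have hslope (s : ℝ) :
      ∂ₓ (compX Φ) p + (s - ∂ₓ (compX Φ) p) / ∂ᵤ (compX Φ) p * ∂ᵤ (compX Φ) p = s := by
    rw [div_mul_cancel₀ _ hXu, add_sub_cancel]
  have hsq (s : ℝ) (hs : s ≠ 0) : a p.1 ^ 2 * s ^ 2 = A (compT Φ p) ^ 2 * ∂ₜ (compT Φ) p := by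
    have hsq := h.sq_mul_sq_totalX0_compX hp ((hslope s).trans_ne hs)
    rwa [hslope s] at hsq
  have hone := hsq 1 one_ne_zero
  have htwo := hsq 2 two_ne_zero
  exact pow_ne_zero 2 (h.source_ne_zero p hp) (by linear_combination (htwo - hone) / 3)

theorem compX_x_mul_compU_u_ne_zero (hp : p ∈ Ω) : ∂ₓ (compX Φ) p * ∂ᵤ (compU Φ) p ≠ 0 := by
  simpa only [h.compX_u_eq_zero hp, zero_mul, sub_zero] using
    h.isPointTransformation.spaceMinor_ne_zero h.isOpen h.timeProjectable hp

theorem compX_x_ne_zero (hp : p ∈ Ω) : ∂ₓ (compX Φ) p ≠ 0 :=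
  left_ne_zero_of_mul (h.compX_x_mul_compU_u_ne_zero hp)

theorem compU_u_ne_zero (hp : p ∈ Ω) : ∂ᵤ (compU Φ) p ≠ 0 :=
  right_ne_zero_of_mul (h.compX_x_mul_compU_u_ne_zero hp)

theorem sq_mul_sq_compX_x (hp : p ∈ Ω) :
    a p.1 ^ 2 * ∂ₓ (compX Φ) p ^ 2 = A (compT Φ p) ^ 2 * ∂ₜ (compT Φ) p := by
  simpa using h.sq_mul_sq_totalX0_compX (r := 0) hp (by simpa using h.compX_x_ne_zero hp)

theorem eventually_compT_eq {v : Jet0} (hv : ∀ q ∈ Ω, dirDeriv v (compT Φ) q = 0) (hp : p ∈ Ω) :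
    ∀ᶠ s : ℝ in 𝓝 0, compT Φ (p + s • v) = compT Φ p ∧
      ∂ₜ (compT Φ) (p + s • v) = ∂ₜ (compT Φ) p := by
  have htv (q : Jet0) (hq : q ∈ Ω) : dirDeriv v (∂ₜ (compT Φ)) q = 0 := by
    rw [dirDeriv_comm h.isOpen h.contDiffOn_compT hq,
      dirDeriv_eq_zero_of_eqOn_const h.isOpen hv hq]
  exact (eventually_eq_of_dirDeriv_eq_zero h.isOpen h.contDiffOn_compT hv hp).and
    (eventually_eq_of_dirDeriv_eq_zero h.isOpen
      (contDiffOn_dirDeriv h.isOpen h.contDiffOn_compT _) htv hp)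

theorem compX_xx_eq_zero (hp : p ∈ Ω) : ∂ₓ (∂ₓ (compX Φ)) p = 0 := by
  refine dirDeriv_eq_zero_of_eventually_mul_sq_eq (k := a p.1 ^ 2)
    (l := A (compT Φ p) ^ 2 * ∂ₜ (compT Φ) p)
    (differentiableAt_of_contDiffOn h.isOpen (contDiffOn_dirDeriv h.isOpen h.contDiffOn_compX _) hp)
    (h.compX_x_ne_zero hp) (pow_ne_zero 2 (h.source_ne_zero p hp)) ?_
  filter_upwards [eventually_add_smul_mem h.isOpen hp (0, 1, 0),
    h.eventually_compT_eq (fun q hq => (h.timeProjectable q hq).1) hp] with s hs hT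
  simpa only [hT.1, hT.2, Prod.fst_add, Prod.smul_fst, smul_zero, add_zero] using
    h.sq_mul_sq_compX_x hs

theorem determining_identity_of_ux (hp : p ∈ Ω) (r : ℝ) :
    ∂ₓ (compX Φ) p * (∂ₜ (compU Φ) p + (b p.1 * p.2.2 - c p.1 * p.2.2 ^ 3) * ∂ᵤ (compU Φ) p) -
        ∂ₜ (compX Φ) p * (∂ₓ (compU Φ) p + r * ∂ᵤ (compU Φ) p) =
      a p.1 ^ 2 * ∂ₓ (compX Φ) p *
        (∂ₓ (∂ₓ (compU Φ)) p + 2 * r * ∂ₓ (∂ᵤ (compU Φ)) p + r ^ 2 * ∂ᵤ (∂ᵤ (compU Φ)) p) +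
      (B (compT Φ p) * compU Φ p - C (compT Φ p) * compU Φ p ^ 3) *
        ∂ₜ (compT Φ) p * ∂ₓ (compX Φ) p := by
  have hXu := h.compX_u_eq_zero hp
  have hXxu : ∂ₓ (∂ᵤ (compX Φ)) p = 0 :=
    dirDeriv_eq_zero_of_eqOn_const h.isOpen (fun q hq => h.compX_u_eq_zero hq) hp _
  have hXuu : ∂ᵤ (∂ᵤ (compX Φ)) p = 0 :=
    dirDeriv_eq_zero_of_eqOn_const h.isOpen (fun q hq => h.compX_u_eq_zero hq) hp _
  have hXx := h.compX_x_ne_zero hp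
  have hdet := h.determining_identity hp (r := r) (by simpa [hXu] using hXx) 0
  rw [hXu, hXxu, hXuu, h.compX_xx_eq_zero hp, ← h.sq_mul_sq_compX_x hp] at hdet
  refine mul_left_cancel₀ (pow_ne_zero 2 hXx) ?_
  linear_combination hdet

theorem compU_uu_eq_zero (hp : p ∈ Ω) : ∂ᵤ (∂ᵤ (compU Φ)) p = 0 := by
  have hcoeff : a p.1 ^ 2 * ∂ₓ (compX Φ) p ≠ 0 :=
    mul_ne_zero (pow_ne_zero 2 (h.source_ne_zero p hp)) (h.compX_x_ne_zero hp)
  refine (mul_eq_zero.1 ?_).resolve_left hcoeff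
  linear_combination h.determining_identity_of_ux hp 0 -
    (h.determining_identity_of_ux hp 1 + h.determining_identity_of_ux hp (-1)) / 2

theorem compX_t_mul_compU_u (hp : p ∈ Ω) :
    ∂ₜ (compX Φ) p * ∂ᵤ (compU Φ) p =
      -(2 * a p.1 ^ 2 * ∂ₓ (compX Φ) p * ∂ₓ (∂ᵤ (compU Φ)) p) := by
  linear_combination (h.determining_identity_of_ux hp (-1) - h.determining_identity_of_ux hp 1) / 2

theorem determining_identity_of_u (hp : p ∈ Ω) :
    ∂ₓ (compX Φ) p * (∂ₜ (compU Φ) p + (b p.1 * p.2.2 - c p.1 * p.2.2 ^ 3) * ∂ᵤ (compU Φ) p) -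
        ∂ₜ (compX Φ) p * ∂ₓ (compU Φ) p =
      a p.1 ^ 2 * ∂ₓ (compX Φ) p * ∂ₓ (∂ₓ (compU Φ)) p +
      (B (compT Φ p) * compU Φ p - C (compT Φ p) * compU Φ p ^ 3) *
        ∂ₜ (compT Φ) p * ∂ₓ (compX Φ) p := by
  linear_combination h.determining_identity_of_ux hp 0

theorem eventually_compX_eq (hp : p ∈ Ω) :
    ∀ᶠ s : ℝ in 𝓝 0, ∂ₜ (compX Φ) (p + s • (0, 0, 1)) = ∂ₜ (compX Φ) p ∧
      ∂ₓ (compX Φ) (p + s • (0, 0, 1)) = ∂ₓ (compX Φ) p := by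
  have hconst (v : Jet0) : ∀ᶠ s : ℝ in 𝓝 0,
      dirDeriv v (compX Φ) (p + s • (0, 0, 1)) = dirDeriv v (compX Φ) p := by
    refine eventually_eq_of_dirDeriv_eq_zero h.isOpen
      (contDiffOn_dirDeriv h.isOpen h.contDiffOn_compX v) (fun q hq => ?_) hp
    rw [dirDeriv_comm h.isOpen h.contDiffOn_compX hq]
    exact dirDeriv_eq_zero_of_eqOn_const h.isOpen (fun _ => h.compX_u_eq_zero) hq v
  exact (hconst _).and (hconst _)

-- The determining identity at `(t, x, u + s)` minus the one at `(t, x, u)`: along the `u`-line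
-- `X_t` and `X_x` are constant and `U`, `U_t`, `U_x`, `U_xx` are affine, hence a cubic in `s`.
theorem eventually_determining_cubic (hp : p ∈ Ω) : ∀ᶠ s in 𝓝 (0 : ℝ),
    ∂ₓ (compX Φ) p * ∂ᵤ (compU Φ) p *
        (C (compT Φ p) * ∂ₜ (compT Φ) p * ∂ᵤ (compU Φ) p ^ 2 - c p.1) * s ^ 3 +
      3 * ∂ₓ (compX Φ) p * ∂ᵤ (compU Φ) p *
        (C (compT Φ p) * ∂ₜ (compT Φ) p * compU Φ p * ∂ᵤ (compU Φ) p - c p.1 * p.2.2) * s ^ 2 +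
      (∂ₓ (compX Φ) p *
          (∂ᵤ (∂ₜ (compU Φ)) p + (b p.1 - 3 * c p.1 * p.2.2 ^ 2) * ∂ᵤ (compU Φ) p) -
        ∂ₜ (compX Φ) p * ∂ᵤ (∂ₓ (compU Φ)) p -
        a p.1 ^ 2 * ∂ₓ (compX Φ) p * ∂ᵤ (∂ₓ (∂ₓ (compU Φ))) p -
        (B (compT Φ p) - 3 * C (compT Φ p) * compU Φ p ^ 2) * ∂ᵤ (compU Φ) p *
          ∂ₜ (compT Φ) p * ∂ₓ (compX Φ) p) * s + 0 = 0 := by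
  have hU := h.contDiffOn_compU
  have hUt := contDiffOn_dirDeriv h.isOpen hU (1, 0, 0)
  have hUx := contDiffOn_dirDeriv h.isOpen hU (0, 1, 0)
  have hUuu (q : Jet0) (hq : q ∈ Ω) : ∂ᵤ (∂ᵤ (compU Φ)) q = 0 := h.compU_uu_eq_zero hq
  have hUwuu (w q : Jet0) (hq : q ∈ Ω) : ∂ᵤ (∂ᵤ (dirDeriv w (compU Φ))) q = 0 :=
    dirDeriv_dirDeriv_dirDeriv_eq_zero h.isOpen hU hUuu hq w
  have hUxxuu (q : Jet0) (hq : q ∈ Ω) : ∂ᵤ (∂ᵤ (∂ₓ (∂ₓ (compU Φ)))) q = 0 :=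
    dirDeriv_dirDeriv_dirDeriv_eq_zero h.isOpen hUx (hUwuu _) hq _
  filter_upwards [eventually_add_smul_mem h.isOpen hp (0, 0, 1),
    h.eventually_compT_eq (fun q hq => (h.timeProjectable q hq).2) hp, h.eventually_compX_eq hp,
    eventually_eq_add_mul_dirDeriv h.isOpen hU hUuu hp,
    eventually_eq_of_dirDeriv_eq_zero h.isOpen (contDiffOn_dirDeriv h.isOpen hU _) hUuu hp,
    eventually_eq_add_mul_dirDeriv h.isOpen hUt (hUwuu _) hp,
    eventually_eq_add_mul_dirDeriv h.isOpen hUx (hUwuu _) hp,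
    eventually_eq_add_mul_dirDeriv h.isOpen (contDiffOn_dirDeriv h.isOpen hUx _) hUxxuu hp]
    with s hs hT hX hU hUu hUt hUx hUxx
  have hdet := h.determining_identity_of_u hs
  simp only [hT.1, hT.2, hX.1, hX.2, hU, hUu, hUt, hUx, hUxx, Prod.fst_add, Prod.snd_add,
    Prod.smul_fst, Prod.smul_snd, smul_eq_mul, mul_zero, add_zero, mul_one] at hdet
  linear_combination hdet - h.determining_identity_of_u hp

theorem source_cubic_coeff_eq (hp : p ∈ Ω) :
    c p.1 = C (compT Φ p) * ∂ₜ (compT Φ) p * ∂ᵤ (compU Φ) p ^ 2 := by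
  have hcoeff := (cubic_coeffs_eq_zero_of_eventually (h.eventually_determining_cubic hp)).1
  exact (sub_eq_zero.1
    ((mul_eq_zero.1 hcoeff).resolve_left (h.compX_x_mul_compU_u_ne_zero hp))).symm

variable (hC : ∀ q ∈ Ω, C (compT Φ q) ≠ 0)
include hC

theorem compU_eq (hp : p ∈ Ω) : compU Φ p = p.2.2 * ∂ᵤ (compU Φ) p := by
  have hcoeff := (cubic_coeffs_eq_zero_of_eventually (h.eventually_determining_cubic hp)).2.1
  rw [h.source_cubic_coeff_eq hp] at hcoeff
  have hfactor : ∂ₓ (compX Φ) p * ∂ᵤ (compU Φ) p * (C (compT Φ p) * ∂ₜ (compT Φ) p *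
      ∂ᵤ (compU Φ) p) ≠ 0 :=
    mul_ne_zero (h.compX_x_mul_compU_u_ne_zero hp)
      (mul_ne_zero (mul_ne_zero (hC p hp) (h.compT_t_ne_zero hp)) (h.compU_u_ne_zero hp))
  refine mul_left_cancel₀ hfactor ?_
  linear_combination hcoeff / 3

theorem compU_ux_eq_zero (hp : p ∈ Ω) : ∂ₓ (∂ᵤ (compU Φ)) p = 0 := by
  refine dirDeriv_eq_zero_of_eventually_mul_sq_eq (k := C (compT Φ p) * ∂ₜ (compT Φ) p)
    (l := c p.1)
    (differentiableAt_of_contDiffOn h.isOpen (contDiffOn_dirDeriv h.isOpen h.contDiffOn_compU _) hp)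
    (h.compU_u_ne_zero hp) (mul_ne_zero (hC p hp) (h.compT_t_ne_zero hp)) ?_
  filter_upwards [eventually_add_smul_mem h.isOpen hp (0, 1, 0),
    h.eventually_compT_eq (fun q hq => (h.timeProjectable q hq).1) hp] with s hs hT
  simpa only [hT.1, hT.2, Prod.fst_add, Prod.smul_fst, smul_zero, add_zero] using
    (h.source_cubic_coeff_eq hs).symm

theorem compX_t_eq_zero (hp : p ∈ Ω) : ∂ₜ (compX Φ) p = 0 := by
  have hprod := h.compX_t_mul_compU_u hp
  rw [h.compU_ux_eq_zero hC hp, mul_zero, neg_zero] at hprod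
  exact (mul_eq_zero.1 hprod).resolve_right (h.compU_u_ne_zero hp)

theorem compU_xxu_eq_zero (hp : p ∈ Ω) : ∂ᵤ (∂ₓ (∂ₓ (compU Φ))) p = 0 := by
  rw [dirDeriv_comm h.isOpen (contDiffOn_dirDeriv h.isOpen h.contDiffOn_compU _) hp]
  refine dirDeriv_eq_zero_of_eqOn_const (k := 0) h.isOpen (fun q hq => ?_) hp _
  rw [dirDeriv_comm h.isOpen h.contDiffOn_compU hq, h.compU_ux_eq_zero hC hq]

theorem compU_ut_add_mul_compU_u (hp : p ∈ Ω) :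
    ∂ₜ (∂ᵤ (compU Φ)) p + b p.1 * ∂ᵤ (compU Φ) p =
      B (compT Φ p) * ∂ₜ (compT Φ) p * ∂ᵤ (compU Φ) p := by
  have hcoeff := (cubic_coeffs_eq_zero_of_eventually (h.eventually_determining_cubic hp)).2.2.1
  rw [h.compX_t_eq_zero hC hp, h.compU_xxu_eq_zero hC hp, h.compU_eq hC hp,
    h.source_cubic_coeff_eq hp, dirDeriv_comm h.isOpen h.contDiffOn_compU hp] at hcoeff
  refine mul_left_cancel₀ (h.compX_x_ne_zero hp) ?_
  linear_combination hcoeff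

theorem eventually_compX_x_eq (hp : p ∈ Ω) :
    ∀ᶠ s : ℝ in 𝓝 0, ∂ₓ (compX Φ) (p + s • (1, 0, 0)) = ∂ₓ (compX Φ) p := by
  refine eventually_eq_of_dirDeriv_eq_zero h.isOpen
    (contDiffOn_dirDeriv h.isOpen h.contDiffOn_compX _) (fun q hq => ?_) hp
  rw [dirDeriv_comm h.isOpen h.contDiffOn_compX hq,
    dirDeriv_eq_zero_of_eqOn_const h.isOpen (fun _ => h.compX_t_eq_zero hC) hq]

end

end IsAdmissible

section ConstantTarget

/-- The function `b / a² + (c / a²)_t / (2 c)` of the coefficients, whose constancy is the criterion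
for reducibility. -/
noncomputable def coeffInvariant (a b c : ℝ → ℝ) (t : ℝ) : ℝ :=
  b t / a t ^ 2 + 1 / 2 * (deriv (fun s => c s / a s ^ 2) t / c t)

variable {Φ : Jet0 → Jet0} {Ω : Set Jet0} {a b c : ℝ → ℝ} {A B C : ℝ} {p : Jet0}

theorem IsAdmissible.div_sq_eq
    (h : IsAdmissible Φ Ω a b c (fun _ => A) (fun _ => B) (fun _ => C)) (hp : p ∈ Ω) :
    c p.1 / a p.1 ^ 2 = C / A ^ 2 * ∂ₓ (compX Φ) p ^ 2 * ∂ᵤ (compU Φ) p ^ 2 := by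
  have hA : A ≠ 0 := h.target_ne_zero p hp
  have ha := h.source_ne_zero p hp
  rw [h.source_cubic_coeff_eq hp, div_eq_iff (pow_ne_zero 2 ha)]
  field_simp
  linear_combination -(C * ∂ᵤ (compU Φ) p ^ 2) * h.sq_mul_sq_compX_x hp

theorem IsAdmissible.deriv_div_sq
    (h : IsAdmissible Φ Ω a b c (fun _ => A) (fun _ => B) (fun _ => C)) (hC : C ≠ 0) (hp : p ∈ Ω) :
    deriv (fun t => c t / a t ^ 2) p.1 =
      2 * (c p.1 / a p.1 ^ 2) * (∂ₜ (∂ᵤ (compU Φ)) p / ∂ᵤ (compU Φ) p) := by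
  have hline : (fun s => c (p.1 + s) / a (p.1 + s) ^ 2) =ᶠ[𝓝 0]
      fun s => C / A ^ 2 * ∂ₓ (compX Φ) p ^ 2 * ∂ᵤ (compU Φ) (p + s • (1, 0, 0)) ^ 2 := by
    filter_upwards [eventually_add_smul_mem h.isOpen hp (1, 0, 0),
      h.eventually_compX_x_eq (fun _ _ => hC) hp] with s hs hX
    rw [← hX, ← h.div_sq_eq hs]
    simp
  have hderiv := ((hasDerivAt_comp_add_smul_zero (differentiableAt_of_contDiffOn h.isOpen
    (contDiffOn_dirDeriv h.isOpen h.contDiffOn_compU (0, 0, 1)) hp) (1, 0, 0)).fun_pow 2).const_mul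
      (C / A ^ 2 * ∂ₓ (compX Φ) p ^ 2)
  have hshift := (hderiv.congr_of_eventuallyEq hline).deriv
  rw [deriv_comp_const_add (fun t => c t / a t ^ 2) p.1 0, add_zero] at hshift
  rw [hshift, h.div_sq_eq hp]
  have hUu := h.compU_u_ne_zero hp
  simp only [Nat.cast_ofNat, Nat.reduceSub, pow_one, zero_smul, add_zero]
  field_simp

theorem IsAdmissible.coeffInvariant_eq
    (h : IsAdmissible Φ Ω a b c (fun _ => A) (fun _ => B) (fun _ => C)) (hC : C ≠ 0) (hp : p ∈ Ω) :
    coeffInvariant a b c p.1 = B / A ^ 2 * ∂ₓ (compX Φ) p ^ 2 := by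
  have hA : A ≠ 0 := h.target_ne_zero p hp
  have ha := h.source_ne_zero p hp
  have hUu := h.compU_u_ne_zero hp
  have hc : c p.1 ≠ 0 := by
    rw [h.source_cubic_coeff_eq hp]
    exact mul_ne_zero (mul_ne_zero hC (h.compT_t_ne_zero hp)) (pow_ne_zero 2 hUu)
  rw [coeffInvariant, h.deriv_div_sq hC hp]
  field_simp
  linear_combination A ^ 2 * h.compU_ut_add_mul_compU_u (fun _ _ => hC) hp -
    B * ∂ᵤ (compU Φ) p * h.sq_mul_sq_compX_x hp

theorem IsAdmissible.eventually_coeffInvariant_eq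
    (h : IsAdmissible Φ Ω a b c (fun _ => A) (fun _ => B) (fun _ => C)) (hC : C ≠ 0) (hp : p ∈ Ω) :
    ∀ᶠ t in 𝓝 p.1, coeffInvariant a b c t = coeffInvariant a b c p.1 := by
  have hshift : ∀ᶠ s in 𝓝 (0 : ℝ), coeffInvariant a b c (p.1 + s) = coeffInvariant a b c p.1 := by
    filter_upwards [eventually_add_smul_mem h.isOpen hp (1, 0, 0),
      h.eventually_compX_x_eq (fun _ _ => hC) hp] with s hs hX
    rw [h.coeffInvariant_eq hC hp, ← hX, ← h.coeffInvariant_eq hC hs]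
    simp
  rw [← map_add_left_nhds_zero p.1]
  exact hshift

theorem ReducibleToConstant.exists_coeffInvariant_eq {I : Set ℝ} (hI : IsPreconnected I)
    (hΩ : IsOpen Ω) (hΩI : Prod.fst '' Ω = I) (ha0 : ∀ t ∈ I, a t ≠ 0)
    (h : ReducibleToConstant a b c Ω) : ∃ lam, ∀ t ∈ I, coeffInvariant a b c t = lam := by
  obtain ⟨Φ, A, B, C, hA, hC, hΦ, hmaps⟩ := h
  have hadm : IsAdmissible Φ Ω a b c (fun _ => A) (fun _ => B) (fun _ => C) :=
    ⟨hΩ, hΦ, hmaps, fun p hp => ha0 p.1 (hΩI ▸ Set.mem_image_of_mem _ hp), fun _ _ => hA⟩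
  have hlocal (t : ℝ) (ht : t ∈ I) :
      coeffInvariant a b c =ᶠ[𝓝 t] fun _ => coeffInvariant a b c t := by
    obtain ⟨p, hp, rfl⟩ := hΩI.symm ▸ ht
    exact hadm.eventually_coeffInvariant_eq hC hp
  have hIo : IsOpen I := hΩI ▸ isOpenMap_fst Ω hΩ
  exact hIo.exists_is_const_of_deriv_eq_zero hI
    (fun t ht => ((differentiableAt_const _).congr_of_eventuallyEq
      (hlocal t ht)).differentiableWithinAt)
    (fun t ht => (hlocal t ht).deriv_eq.trans (deriv_const t _))

end ConstantTarget

section Scaling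

/-- The transformation `t' = τ(t)`, `x' = x`, `u' = ψ(t) u`, which realises the reduction. -/
def scaling (τ ψ : ℝ → ℝ) (p : Jet0) : Jet0 := (τ p.1, p.2.1, ψ p.1 * p.2.2)

variable {I : Set ℝ} {Ω : Set Jet0} {τ ψ : ℝ → ℝ} {p : Jet0}

theorem dirDeriv_comp_fst (hτ : DifferentiableAt ℝ τ p.1) (v : Jet0) :
    dirDeriv v (fun q => τ q.1) p = deriv τ p.1 * v.1 := by
  have hcomp : HasFDerivAt (fun q : Jet0 => τ q.1) _ p :=
    hτ.hasDerivAt.comp_hasFDerivAt p (hasFDerivAt_fst (𝕜 := ℝ) (p := p))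
  rw [dirDeriv, hcomp.fderiv]
  rfl

theorem dirDeriv_compX_scaling (v : Jet0) : dirDeriv v (compX (scaling τ ψ)) p = v.2.1 := by
  have hX : HasFDerivAt (compX (scaling τ ψ)) _ p := (hasFDerivAt_snd (p := p) (𝕜 := ℝ)).fst
  rw [dirDeriv, hX.fderiv]
  rfl

theorem dirDeriv_compU_scaling (hψ : DifferentiableAt ℝ ψ p.1) (v : Jet0) :
    dirDeriv v (compU (scaling τ ψ)) p = deriv ψ p.1 * v.1 * p.2.2 + ψ p.1 * v.2.2 := by
  have hcomp : HasFDerivAt (fun q : Jet0 => ψ q.1) _ p :=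
    hψ.hasDerivAt.comp_hasFDerivAt p (hasFDerivAt_fst (𝕜 := ℝ) (p := p))
  have hU : HasFDerivAt (compU (scaling τ ψ)) _ p :=
    hcomp.mul (hasFDerivAt_snd (p := p) (𝕜 := ℝ)).snd
  rw [dirDeriv, hU.fderiv]
  simp only [add_apply, smul_apply, ContinuousLinearMap.comp_apply,
    ContinuousLinearMap.coe_fst', ContinuousLinearMap.coe_snd', smul_eq_mul]
  ring

section

variable (hI : IsOpen I) (hΩI : Set.MapsTo Prod.fst Ω I) (hτ : ContDiffOn ℝ ∞ τ I)
  (hψ : ContDiffOn ℝ ∞ ψ I)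

include hΩI hτ hψ in
theorem contDiffOn_scaling : ContDiffOn ℝ ∞ (scaling τ ψ) Ω :=
  (hτ.comp contDiffOn_fst hΩI).prodMk
    (contDiffOn_snd.fst.prodMk ((hψ.comp contDiffOn_fst hΩI).mul contDiffOn_snd.snd))

include hI hΩI hτ in
theorem timeProjectable_scaling : TimeProjectable (scaling τ ψ) Ω := by
  have hT {p : Jet0} (hp : p ∈ Ω) (v : Jet0) := dirDeriv_comp_fst (p := p)
    (differentiableAt_of_contDiffOn hI hτ (hΩI hp)) v
  exact fun p hp => ⟨(hT hp _).trans (mul_zero _), (hT hp _).trans (mul_zero _)⟩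

variable (hΩ : IsOpen Ω)

include hI hΩI hτ hψ hΩ in
theorem isPointTransformation_scaling (hinj : Set.InjOn τ I) (hτ0 : ∀ t ∈ I, deriv τ t ≠ 0)
    (hψ0 : ∀ t ∈ I, ψ t ≠ 0) : IsPointTransformation (scaling τ ψ) Ω where
  smooth := contDiffOn_scaling hΩI hτ hψ
  injOn := by
    rintro ⟨t, x, u⟩ hp ⟨t', x', u'⟩ hp' heq
    obtain ⟨hτt, hx, hψu⟩ : τ t = τ t' ∧ x = x' ∧ ψ t * u = ψ t' * u' := by
      simpa [scaling] using heq
    obtain rfl : t = t' := hinj (hΩI hp) (hΩI hp') hτt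
    rw [hx, mul_left_cancel₀ (hψ0 t (hΩI hp)) hψu]
  det_ne_zero p hp := by
    have hT : ∂ₜ (compT (scaling τ ψ)) p = deriv τ p.1 * 1 :=
      dirDeriv_comp_fst (differentiableAt_of_contDiffOn hI hτ (hΩI hp)) _
    rw [(timeProjectable_scaling hI hΩI hτ).det_fderiv_eq hp
      (differentiableAt_of_contDiffOn hΩ (contDiffOn_scaling hΩI hτ hψ) hp), hT]
    simpa [dirDeriv_compX_scaling,
      dirDeriv_compU_scaling (differentiableAt_of_contDiffOn hI hψ (hΩI hp))] using
      ⟨hτ0 p.1 (hΩI hp), hψ0 p.1 (hΩI hp)⟩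

theorem totalX1_totalX0_compX_scaling (j : Jet2) :
    totalX1 (totalX0 (compX (scaling τ ψ))) j = 0 := by
  have hone : totalX0 (compX (scaling τ ψ)) = fun _ => 1 :=
    funext fun z => dirDeriv_compX_scaling _
  rw [hone, totalX1, fderiv_const_apply, zero_apply]

include hI hΩI hψ hΩ in
theorem totalX1_totalX0_compU_scaling {j : Jet2} (hj : j.base ∈ Ω) :
    totalX1 (totalX0 (compU (scaling τ ψ))) j = ψ j.t * j.uxx := by
  have hU : ContDiffOn ℝ ∞ (compU (scaling τ ψ)) Ω :=
    (hψ.comp contDiffOn_fst hΩI).mul contDiffOn_snd.snd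
  have hψd {q : Jet0} (hq : q ∈ Ω) : DifferentiableAt ℝ ψ q.1 :=
    differentiableAt_of_contDiffOn hI hψ (hΩI hq)
  have hUx (q : Jet0) (hq : q ∈ Ω) : ∂ₓ (compU (scaling τ ψ)) q = 0 := by
    simp [dirDeriv_compU_scaling (hψd hq)]
  have hUu (q : Jet0) (hq : q ∈ Ω) : ∂ᵤ (compU (scaling τ ψ)) q = ψ q.1 := by
    simp [dirDeriv_compU_scaling (hψd hq)]
  rw [totalX1_totalX0 hΩ hU hj, dirDeriv_eq_zero_of_eqOn_const hΩ hUx hj,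
    dirDeriv_congr hΩ hUu hj, dirDeriv_congr hΩ hUu hj, hUu _ hj,
    dirDeriv_comp_fst (hψd hj), dirDeriv_comp_fst (hψd hj)]
  simp [Jet2.base, mul_comm]

include hI hΩI hτ hψ hΩ in
theorem mapsEquation_scaling {a b c A B C : ℝ → ℝ}
    (h : IsPointTransformation (scaling τ ψ) Ω) (hψ0 : ∀ t ∈ I, ψ t ≠ 0)
    (hA : ∀ t ∈ I, A (τ t) ^ 2 * deriv τ t = a t ^ 2)
    (hB : ∀ t ∈ I, deriv ψ t + b t * ψ t = B (τ t) * deriv τ t * ψ t)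
    (hC : ∀ t ∈ I, C (τ t) * deriv τ t * ψ t ^ 2 = c t) :
    MapsEquation (scaling τ ψ) Ω (equation a b c) (equation A B C) := by
  intro j hj _
  have ht : j.t ∈ I := hΩI hj
  have hT : ∂ₜ (compT (scaling τ ψ)) j.base = deriv τ j.t * 1 :=
    dirDeriv_comp_fst (differentiableAt_of_contDiffOn hI hτ ht) _
  have hXx : totalX0 (compX (scaling τ ψ)) j.toJet1 = 1 := dirDeriv_compX_scaling _
  have hXt : totalT0 (compX (scaling τ ψ)) j.toJet1 = 0 := dirDeriv_compX_scaling _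
  have hUt : totalT0 (compU (scaling τ ψ)) j.toJet1 = deriv ψ j.t * 1 * j.u + ψ j.t * j.ut :=
    dirDeriv_compU_scaling (p := j.base) (differentiableAt_of_contDiffOn hI hψ ht) _
  rw [h.prolong_mem_equation_iff hΩ (timeProjectable_scaling hI hΩI hτ) hj
    (hXx.trans_ne one_ne_zero), totalX1_totalX0_compX_scaling,
    totalX1_totalX0_compU_scaling hI hΩI hψ hΩ hj, hXx, hXt, hUt, hT]
  change j.ut = a j.t ^ 2 * j.uxx + b j.t * j.u - c j.t * j.u ^ 3 ↔
    _ = A (τ j.t) ^ 2 * _ * _ + (B (τ j.t) * (ψ j.t * j.u) - C (τ j.t) * (ψ j.t * j.u) ^ 3) * _ * _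
  rw [← hA j.t ht, ← hC j.t ht]
  constructor
  · intro heq
    linear_combination ψ j.t * heq + j.u * hB j.t ht
  · intro heq
    refine mul_left_cancel₀ (hψ0 j.t ht) ?_
    linear_combination heq - j.u * hB j.t ht

end

end Scaling

theorem exists_contDiffOn_deriv_eq {I : Set ℝ} (hIo : IsOpen I) (hIc : IsConnected I) {f : ℝ → ℝ}
    (hf : ContDiffOn ℝ ∞ f I) :
    ∃ F : ℝ → ℝ, ContDiffOn ℝ ∞ F I ∧ ∀ t ∈ I, HasDerivAt F (f t) t := by
  obtain ⟨t₀, ht₀⟩ := hIc.nonempty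
  have hderiv (t : ℝ) (ht : t ∈ I) : HasDerivAt (fun r => ∫ s in t₀..r, f s) (f t) t :=
    intervalIntegral.integral_hasDerivAt_right
      (hf.continuousOn.mono (hIc.isPreconnected.ordConnected.uIcc_subset ht₀ ht)).intervalIntegrable
      (hf.continuousOn.stronglyMeasurableAtFilter hIo t ht)
      (hf.continuousOn.continuousAt (hIo.mem_nhds ht))
  exact ⟨_, (contDiffOn_infty_iff_deriv_of_isOpen hIo).2
    ⟨fun t ht => (hderiv t ht).differentiableAt.differentiableWithinAt,
      hf.congr fun t ht => (hderiv t ht).deriv⟩, hderiv⟩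

theorem exists_eq_mul_exp {I : Set ℝ} (hIo : IsOpen I) (hIc : IsPreconnected I) {g γ γ' : ℝ → ℝ}
    (hγ : ∀ t ∈ I, HasDerivAt γ (γ' t) t) (hg : ∀ t ∈ I, HasDerivAt g (γ' t * g t) t) :
    ∃ k, ∀ t ∈ I, g t = k * Real.exp (γ t) := by
  have hzero (t : ℝ) (ht : t ∈ I) : HasDerivAt (fun s => g s * Real.exp (-γ s)) 0 t :=
    ((hg t ht).fun_mul (hγ t ht).fun_neg.exp).congr_deriv (by ring)
  obtain ⟨k, hk⟩ := hIo.exists_is_const_of_deriv_eq_zero hIc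
    (fun t ht => (hzero t ht).differentiableAt.differentiableWithinAt)
    (fun t ht => (hzero t ht).deriv)
  refine ⟨k, fun t ht => ?_⟩
  rw [← hk t ht, mul_assoc, ← Real.exp_add, neg_add_cancel, Real.exp_zero, mul_one]

theorem reducibleToConstant_of_coeffInvariant_eq {I : Set ℝ} (hIo : IsOpen I) (hIc : IsConnected I)
    {a b c : ℝ → ℝ} (ha : ContDiffOn ℝ ∞ a I) (hb : ContDiffOn ℝ ∞ b I) (hc : ContDiffOn ℝ ∞ c I)
    (ha0 : ∀ t ∈ I, a t ≠ 0) (hc0 : ∀ t ∈ I, c t ≠ 0) {Ω : Set Jet0} (hΩ : IsOpen Ω)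
    (hΩI : Set.MapsTo Prod.fst Ω I) {lam : ℝ} (hlam : ∀ t ∈ I, coeffInvariant a b c t = lam) :
    ReducibleToConstant a b c Ω := by
  obtain ⟨τ, hτ, hτ'⟩ := exists_contDiffOn_deriv_eq hIo hIc (ha.pow 2)
  obtain ⟨β, hβ, hβ'⟩ := exists_contDiffOn_deriv_eq hIo hIc
    ((contDiffOn_const.mul (ha.pow 2)).sub hb : ContDiffOn ℝ ∞ (fun t => lam * a t ^ 2 - b t) I)
  have hquot (t : ℝ) (ht : t ∈ I) : HasDerivAt (fun s => c s / a s ^ 2)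
      (2 * (lam * a t ^ 2 - b t) * (c t / a t ^ 2)) t := by
    have hdiff : DifferentiableAt ℝ (fun s => c s / a s ^ 2) t :=
      differentiableAt_of_contDiffOn hIo (hc.div (ha.pow 2) fun t ht => pow_ne_zero 2 (ha0 t ht))
        ht
    refine hdiff.hasDerivAt.congr_deriv ?_
    have hat := ha0 t ht
    have hct := hc0 t ht
    rw [← hlam t ht, coeffInvariant]
    field_simp
    ring
  obtain ⟨C, hC⟩ := exists_eq_mul_exp hIo hIc.isPreconnected
    (fun t ht => (hβ' t ht).const_mul 2) hquot
  have hC0 : C ≠ 0 := by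
    rintro rfl
    obtain ⟨t, ht⟩ := hIc.nonempty
    simpa [ha0 t ht, hc0 t ht] using hC t ht
  have hτ_pos (t : ℝ) (ht : t ∈ I) : 0 < deriv τ t := by
    rw [(hτ' t ht).deriv]
    exact sq_pos_iff.2 (ha0 t ht)
  have hinj : Set.InjOn τ I :=
    (strictMonoOn_of_deriv_pos hIc.isPreconnected.convex hτ.continuousOn
      fun t ht => hτ_pos t (interior_subset ht)).injOn
  have hpoint := isPointTransformation_scaling hIo hΩI hτ hβ.exp hΩ hinj
    (fun t ht => (hτ_pos t ht).ne') fun t _ => (Real.exp_pos (β t)).ne'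
  refine ⟨_, 1, lam, C, one_ne_zero, hC0, hpoint, mapsEquation_scaling hIo hΩI hτ hβ.exp hΩ hpoint
    (fun t _ => (Real.exp_pos (β t)).ne') (fun t ht => ?_) (fun t ht => ?_) (fun t ht => ?_)⟩
  · rw [(hτ' t ht).deriv, one_pow, one_mul]
  · rw [(hτ' t ht).deriv, (hβ' t ht).exp.deriv]
    ring
  · rw [(hτ' t ht).deriv, ← Real.exp_nat_mul, mul_right_comm]
    exact (div_eq_iff (pow_ne_zero 2 (ha0 t ht))).1 (hC t ht) |>.symm

end NWS

theorem theorem2 (I : Set ℝ) (hIo : IsOpen I) (hIc : IsConnected I)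
    (a b c : ℝ → ℝ)
    (ha : ContDiffOn ℝ ∞ a I) (hb : ContDiffOn ℝ ∞ b I) (hc : ContDiffOn ℝ ∞ c I)
    (ha0 : ∀ t ∈ I, a t ≠ 0) (hc0 : ∀ t ∈ I, c t ≠ 0)
    (Ω : Set (ℝ × ℝ × ℝ)) (hΩo : IsOpen Ω) (hΩI : Prod.fst '' Ω = I) :
    NWS.ReducibleToConstant a b c Ω ↔
      ∃ lam : ℝ, ∀ t ∈ I,
        b t / a t ^ 2 + 1 / 2 * (deriv (fun s => c s / a s ^ 2) t / c t) = lam :=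
  ⟨NWS.ReducibleToConstant.exists_coeffInvariant_eq hIc.isPreconnected hΩo hΩI ha0,
    fun ⟨_, hlam⟩ => NWS.reducibleToConstant_of_coeffInvariant_eq hIo hIc ha hb hc ha0 hc0 hΩo
      (fun _ hp => hΩI ▸ Set.mem_image_of_mem _ hp) hlam⟩
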